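/- Let $\mathbb{K}$ be $\mathbb{R}$ or $\mathbb{C}$, and let $\mathfrak{g}$ be a finite-dimensional $\mathbb{K}$-vector space with a norm. A 3-Lie algebra structure on a vector space $\mathfrak g$ is a linear map $\pi:\wedge^3\mathfrak g\to\mathfrak g$ such that $$\pi(x_1,x_2,\pi(x_3,x_4,x_5))=\pi(\pi(x_1,x_2,x_3),x_4,x_5)+\pi(x_3,\pi(x_1,x_2,x_4),x_5)+\pi(x_3,x_4,\pi(x_1,x_2,x_5))$$ for all $x_i\in\mathfrak g$. A 3-Lie subalgebra of $(\mathfrak g,\pi)$ is a linear subspace $\mathfrak h$ with $\pi(\mathfrak h,\mathfrak h,\mathfrak h)\subset\mathfrak h$. It has a representation on $\mathfrak g/\mathfrak h$, given by $\overline{\mathrm{ad}}_{u\wedge v}\,\overline{x}=\overline{\pi(u,v,x)}$ for $u,v\in\mathfrak h$ and $x\in\mathfrak g$. Let $H^2(\mathfrak h,\mathfrak g/\mathfrak h)$ be the second cohomology of $(\mathfrak h,\pi|_{\mathfrak h})$ with coefficients in it, that is, the cohomology at the middle term of the complex $$\mathrm{Hom}(\mathfrak h,\mathfrak g/\mathfrak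 h)\xrightarrow{\ \partial\ }\mathrm{Hom}(\wedge^3\mathfrak h,\mathfrak g/\mathfrak h)\xrightarrow{\ \partial\ }\mathrm{Hom}(\wedge^2\mathfrak h\otimes\wedge^3\mathfrak h,\mathfrak g/\mathfrak h),$$ where, with $\rho=\overline{\mathrm{ad}}$, $$(\partial\theta)(x_1,y_1,x_2)=-\theta(\pi(x_1,y_1,x_2))+\rho(x_1,y_1)\theta(x_2)+\rho(y_1,x_2)\theta(x_1)+\rho(x_2,x_1)\theta(y_1)$$ in degree 1, and in degree 2 $$\begin{aligned}(\partial\theta)(x_1\wedge y_1,x_2\wedge y_2\wedge x_3)={}&-\theta(\pi(x_1,y_1,x_2),y_2,x_3)-\theta(x_2,\pi(x_1,y_1,y_2),x_3)\\&-\theta(x_2,y_2,\pi(x_1,y_1,x_3))+\theta(x_1,y_1,\pi(x_2,y_2,x_3))\\&+\rho(x_1,y_1)\theta(x_2,y_2,x_3)-\rho(x_2,y_2)\theta(x_1,y_1,x_3)\\&-\rho(y_2,x_3)\theta(x_1,y_1,x_2)-\rho(x_3,x_2)\theta(x_1,y_1,y_2).\end{aligned}$$ **Theorem (Stability of 3-Lie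 subalgebras).** Let $\pi$ be a 3-Lie algebra structure on $\mathfrak g$ and let $\mathfrak h\subset\mathfrak g$ be a $k$-dimensional 3-Lie subalgebra of $(\mathfrak g,\pi)$. If $H^2(\mathfrak h,\mathfrak g/\mathfrak h)=0$, then $\mathfrak h$ is stable: for every neighbourhood $W$ of $\mathfrak h$ in the Grassmannian $\mathrm{Gr}_k(\mathfrak g)$ of $k$-dimensional subspaces of $\mathfrak g$ there is a $\delta>0$ such that, for every 3-Lie algebra structure $\pi'$ on $\mathfrak g$ with $$\sup_{\|x\|,\|y\|,\|z\|\le 1}\|\pi'(x,y,z)-\pi(x,y,z)\|\le\delta,$$ there is an $\mathfrak h'\in W$ that is a 3-Lie subalgebra of $(\mathfrak g,\pi')$. -/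

import Mathlib

open Topology

/-! ### Alternating maps in two and three variables -/

namespace AltAux

variable {R M N : Type*} [CommRing R] [AddCommGroup M] [Module R M] [AddCommGroup N] [Module R N]

/-- An alternating bilinear map, from a function of two variables. -/
def mk₂ (f : M → M → N)
    (add₁ : ∀ x x' y, f (x + x') y = f x y + f x' y)
    (add₂ : ∀ x y y', f x (y + y') = f x y + f x y')
    (smul₁ : ∀ (c : R) x y, f (c • x) y = c • f x y)
    (smul₂ : ∀ (c : R) x y, f x (c • y) = c • f x y)
    (alt : ∀ x, f x x = 0) : M [⋀^Fin 2]→ₗ[R] N where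
  toFun v := f (v 0) (v 1)
  map_update_add' v i x y := by
    fin_cases i <;> simp [add₁, add₂]
  map_update_smul' v i c x := by
    fin_cases i <;> simp [smul₁, smul₂]
  map_eq_zero_of_eq' v i j h hij := by
    fin_cases i <;> fin_cases j <;> simp_all

@[simp] theorem mk₂_apply (f : M → M → N) (h₁ h₂ h₃ h₄ h₅) (v : Fin 2 → M) :
    (mk₂ (R := R) f h₁ h₂ h₃ h₄ h₅) v = f (v 0) (v 1) := rfl

theorem fin3_ne : (0 : Fin 3) ≠ 1 ∧ (0 : Fin 3) ≠ 2 ∧ (1 : Fin 3) ≠ 2 := by decide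

theorem fin3_cases : ∀ i : Fin 3, i = 0 ∨ i = 1 ∨ i = 2 := by decide

/-- An alternating trilinear map, from a function of three variables. -/
def mk₃ (f : M → M → M → N)
    (add₁ : ∀ x x' y z, f (x + x') y z = f x y z + f x' y z)
    (smul₁ : ∀ (c : R) x y z, f (c • x) y z = c • f x y z)
    (swap₁₂ : ∀ x y z, f x y z = - f y x z)
    (swap₂₃ : ∀ x y z, f x y z = - f x z y)
    (alt : ∀ x z, f x x z = 0) : M [⋀^Fin 3]→ₗ[R] N where
  toFun v := f (v 0) (v 1) (v 2)
  map_update_add' v i x y := by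
    have add₂ : ∀ x y y' z, f x (y + y') z = f x y z + f x y' z := fun x y y' z => by
      rw [swap₁₂, add₁, swap₁₂ y, swap₁₂ y']; abel
    have add₃ : ∀ x y z z', f x y (z + z') = f x y z + f x y z' := fun x y z z' => by
      rw [swap₂₃, add₂, swap₂₃ x z, swap₂₃ x z']; abel
    obtain ⟨h01, h02, h12⟩ := fin3_ne
    obtain rfl | rfl | rfl := fin3_cases i
    all_goals
      simp only [Function.update_self, Function.update_of_ne h01, Function.update_of_ne h02,
        Function.update_of_ne h12, Function.update_of_ne h01.symm, Function.update_of_ne h02.symm,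
        Function.update_of_ne h12.symm, add₁, add₂, add₃]
  map_update_smul' v i c x := by
    have smul₂ : ∀ (c : R) x y z, f x (c • y) z = c • f x y z := fun c x y z => by
      rw [swap₁₂, smul₁, swap₁₂ y, smul_neg, neg_neg]
    have smul₃ : ∀ (c : R) x y z, f x y (c • z) = c • f x y z := fun c x y z => by
      rw [swap₂₃, smul₂, swap₂₃ x z, smul_neg, neg_neg]
    obtain ⟨h01, h02, h12⟩ := fin3_ne
    obtain rfl | rfl | rfl := fin3_cases i
    all_goals
      simp only [Function.update_self, Function.update_of_ne h01, Function.update_of_ne h02,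
        Function.update_of_ne h12, Function.update_of_ne h01.symm, Function.update_of_ne h02.symm,
        Function.update_of_ne h12.symm, smul₁, smul₂, smul₃]
  map_eq_zero_of_eq' v i j h hij := by
    have alt₂ : ∀ x z, f z x x = 0 := fun x z => by
      rw [swap₁₂, swap₂₃, alt, neg_zero, neg_zero]
    have alt₃ : ∀ x z, f x z x = 0 := fun x z => by
      rw [swap₂₃, alt, neg_zero]
    fin_cases i <;> fin_cases j
    · exact absurd rfl hij
    · rw [show v 0 = v 1 from h]; exact alt _ _
    · rw [show v 0 = v 2 from h]; exact alt₃ _ _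
    · rw [show v 1 = v 0 from h]; exact alt _ _
    · exact absurd rfl hij
    · rw [show v 1 = v 2 from h]; exact alt₂ _ _
    · rw [show v 2 = v 0 from h]; exact alt₃ _ _
    · rw [show v 2 = v 1 from h]; exact alt₂ _ _
    · exact absurd rfl hij

@[simp] theorem mk₃_apply (f : M → M → M → N) (h₁ h₂ h₃ h₄ h₅) (v : Fin 3 → M) :
    (mk₃ (R := R) f h₁ h₂ h₃ h₄ h₅) v = f (v 0) (v 1) (v 2) := rfl

theorem ext₂ {f g : M [⋀^Fin 2]→ₗ[R] N} (h : ∀ x y, f ![x, y] = g ![x, y]) : f = g := by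
  ext v
  have := h (v 0) (v 1)
  rwa [show ![v 0, v 1] = v from by ext i; fin_cases i <;> rfl] at this

theorem ext₃ {f g : M [⋀^Fin 3]→ₗ[R] N} (h : ∀ x y z, f ![x, y, z] = g ![x, y, z]) : f = g := by
  ext v
  have := h (v 0) (v 1) (v 2)
  rwa [show ![v 0, v 1, v 2] = v from by ext i; fin_cases i <;> rfl] at this

section two
variable (f : M [⋀^Fin 2]→ₗ[R] N)

theorem swap (x y : M) : f ![x, y] = - f ![y, x] := by
  rw [← f.map_swap ![y, x] (i := 0) (j := 1) (by decide)]
  congr 1; ext i; fin_cases i <;> rfl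

@[simp] theorem alt₂ (x : M) : f ![x, x] = 0 :=
  f.map_eq_zero_of_eq _ (i := 0) (j := 1) rfl (by decide)

theorem add₁ (x x' y : M) : f ![x + x', y] = f ![x, y] + f ![x', y] := f.map_vecCons_add _ _ _

theorem smul₁ (c : R) (x y : M) : f ![c • x, y] = c • f ![x, y] := f.map_vecCons_smul _ _ _

theorem add₂ (x y y' : M) : f ![x, y + y'] = f ![x, y] + f ![x, y'] := by
  rw [swap, add₁, swap f y, swap f y']; abel

theorem smul₂ (c : R) (x y : M) : f ![x, c • y] = c • f ![x, y] := by
  rw [swap, smul₁, swap f y, smul_neg, neg_neg]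

end two

section three
variable (f : M [⋀^Fin 3]→ₗ[R] N)

theorem swap₁₂ (x y z : M) : f ![x, y, z] = - f ![y, x, z] := by
  rw [← f.map_swap ![y, x, z] (i := 0) (j := 1) (by decide)]
  congr 1; ext i; fin_cases i <;> rfl

theorem swap₂₃ (x y z : M) : f ![x, y, z] = - f ![x, z, y] := by
  rw [← f.map_swap ![x, z, y] (i := 1) (j := 2) (by decide)]
  congr 1; ext i; fin_cases i <;> rfl

@[simp] theorem alt₁₂ (x z : M) : f ![x, x, z] = 0 :=
  f.map_eq_zero_of_eq _ (i := 0) (j := 1) rfl (by decide)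

theorem add₃₁ (x x' y z : M) : f ![x + x', y, z] = f ![x, y, z] + f ![x', y, z] :=
  f.map_vecCons_add _ _ _

theorem smul₃₁ (c : R) (x y z : M) : f ![c • x, y, z] = c • f ![x, y, z] :=
  f.map_vecCons_smul _ _ _

theorem add₃₂ (x y y' z : M) : f ![x, y + y', z] = f ![x, y, z] + f ![x, y', z] := by
  rw [swap₁₂, add₃₁, swap₁₂ f y, swap₁₂ f y']; abel

theorem smul₃₂ (c : R) (x y z : M) : f ![x, c • y, z] = c • f ![x, y, z] := by
  rw [swap₁₂, smul₃₁, swap₁₂ f y, smul_neg, neg_neg]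

theorem add₃₃ (x y z z' : M) : f ![x, y, z + z'] = f ![x, y, z] + f ![x, y, z'] := by
  rw [swap₂₃, add₃₂, swap₂₃ f x z, swap₂₃ f x z']; abel

theorem smul₃₃ (c : R) (x y z : M) : f ![x, y, c • z] = c • f ![x, y, z] := by
  rw [swap₂₃, smul₃₂, swap₂₃ f x z, smul_neg, neg_neg]

theorem neg₃₁ (x y z : M) : f ![-x, y, z] = - f ![x, y, z] := by
  have := smul₃₁ f (-1) x y z
  rwa [neg_one_smul, neg_one_smul] at this

theorem neg₃₂ (x y z : M) : f ![x, -y, z] = - f ![x, y, z] := by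
  have := smul₃₂ f (-1) x y z
  rwa [neg_one_smul, neg_one_smul] at this

theorem neg₃₃ (x y z : M) : f ![x, y, -z] = - f ![x, y, z] := by
  have := smul₃₃ f (-1) x y z
  rwa [neg_one_smul, neg_one_smul] at this

end three

end AltAux

/-! ### 3-Lie algebras, subalgebras and representations -/

/-- A 3-Lie algebra structure on the `R`-module `g`: an alternating trilinear bracket
which satisfies the fundamental (Filippov) identity. -/
structure ThreeLie (R g : Type*) [CommRing R] [AddCommGroup g] [Module R g] where
  bracket : g [⋀^Fin 3]→ₗ[R] g
  fundamental : ∀ x₁ x₂ x₃ x₄ x₅ : g,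
    bracket ![x₁, x₂, bracket ![x₃, x₄, x₅]] =
      bracket ![bracket ![x₁, x₂, x₃], x₄, x₅] + bracket ![x₃, bracket ![x₁, x₂, x₄], x₅]
        + bracket ![x₃, x₄, bracket ![x₁, x₂, x₅]]

namespace ThreeLie

variable {R g V : Type*} [CommRing R] [AddCommGroup g] [Module R g] [AddCommGroup V] [Module R V]

/-- A representation of the 3-Lie algebra `(g, π)` on `V`. -/
structure Rep (π : ThreeLie R g) (V : Type*) [AddCommGroup V] [Module R V] where
  ρ : g [⋀^Fin 2]→ₗ[R] (V →ₗ[R] V)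
  comm : ∀ x₁ x₂ x₃ x₄ : g,
    ρ ![x₁, x₂] ∘ₗ ρ ![x₃, x₄] =
      ρ ![π.bracket ![x₁, x₂, x₃], x₄] + ρ ![x₃, π.bracket ![x₁, x₂, x₄]]
        + ρ ![x₃, x₄] ∘ₗ ρ ![x₁, x₂]
  bracket_right : ∀ x₁ x₂ x₃ x₄ : g,
    ρ ![x₁, π.bracket ![x₂, x₃, x₄]] =
      ρ ![x₃, x₄] ∘ₗ ρ ![x₁, x₂] - ρ ![x₂, x₄] ∘ₗ ρ ![x₁, x₃] + ρ ![x₂, x₃] ∘ₗ ρ ![x₁, x₄]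

/-- The linear subspace `h` is a 3-Lie subalgebra of `(g, π)`. -/
def IsSubalgebra (π : ThreeLie R g) (h : Submodule R g) : Prop :=
  ∀ x ∈ h, ∀ y ∈ h, ∀ z ∈ h, π.bracket ![x, y, z] ∈ h

/-- A 3-Lie subalgebra with the restricted bracket. -/
def restrict (π : ThreeLie R g) (h : Submodule R g) (hh : π.IsSubalgebra h) : ThreeLie R h where
  bracket := AltAux.mk₃ (fun x y z => ⟨π.bracket ![x, y, z], hh x x.2 y y.2 z z.2⟩)
    (fun _ _ _ _ => Subtype.ext (AltAux.add₃₁ _ _ _ _ _))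
    (fun _ _ _ _ => Subtype.ext (AltAux.smul₃₁ _ _ _ _ _))
    (fun _ _ _ => Subtype.ext (AltAux.swap₁₂ _ _ _ _))
    (fun _ _ _ => Subtype.ext (AltAux.swap₂₃ _ _ _ _))
    (fun _ _ => Subtype.ext (AltAux.alt₁₂ _ _ _))
  fundamental x₁ x₂ x₃ x₄ x₅ := Subtype.ext (π.fundamental x₁ x₂ x₃ x₄ x₅)

@[simp] theorem restrict_bracket (π : ThreeLie R g) (h : Submodule R g) (hh : π.IsSubalgebra h)
    (x y z : h) : ((π.restrict h hh).bracket ![x, y, z] : g) = π.bracket ![(x : g), y, z] := rfl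

/-- The map `w ↦ π(x, y, w)`. -/
def ad (π : ThreeLie R g) (x y : g) : g →ₗ[R] g where
  toFun w := π.bracket ![x, y, w]
  map_add' := AltAux.add₃₃ _ _ _
  map_smul' c := AltAux.smul₃₃ _ c _ _

/-- The representation of a subalgebra `h` on `g ⧸ h` that is induced by the adjoint
representation: `(u, v)` sends the class of `x` to the class of `π(u, v, x)`. -/
def quotRep (π : ThreeLie R g) (h : Submodule R g) (hh : π.IsSubalgebra h) :
    (π.restrict h hh).Rep (g ⧸ h) where
  ρ := AltAux.mk₂
    (fun u v => h.mapQ h (π.ad u v) (fun w hw => hh u u.2 v v.2 w hw))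
    (fun x x' y => by
      ext w; exact congrArg h.mkQ (AltAux.add₃₁ π.bracket (x : g) x' y w))
    (fun x y y' => by
      ext w; exact congrArg h.mkQ (AltAux.add₃₂ π.bracket (x : g) y y' w))
    (fun c x y => by
      ext w; exact congrArg h.mkQ (AltAux.smul₃₁ π.bracket c (x : g) y w))
    (fun c x y => by
      ext w; exact congrArg h.mkQ (AltAux.smul₃₂ π.bracket c (x : g) y w))
    (fun x => by
      ext w; exact congrArg h.mkQ (AltAux.alt₁₂ π.bracket (x : g) w))
  comm x₁ x₂ x₃ x₄ := by
    ext w; exact congrArg h.mkQ (π.fundamental x₁ x₂ x₃ x₄ w)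
  bracket_right x₁ x₂ x₃ x₄ := by
    ext w
    refine congrArg h.mkQ
      (a₁ := π.bracket ![(x₁ : g), π.bracket ![(x₂ : g), x₃, x₄], w])
      (a₂ := π.bracket ![(x₃ : g), x₄, π.bracket ![(x₁ : g), x₂, w]]
        - π.bracket ![(x₂ : g), x₄, π.bracket ![(x₁ : g), x₃, w]]
        + π.bracket ![(x₂ : g), x₃, π.bracket ![(x₁ : g), x₄, w]]) ?_
    rw [AltAux.swap₂₃, π.fundamental, AltAux.swap₂₃ _ (x₁ : g) w x₂,
      AltAux.swap₂₃ _ (x₁ : g) w x₃, AltAux.swap₂₃ _ (x₁ : g) w x₄,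
      AltAux.swap₁₂ _ (-_) _ _, AltAux.swap₂₃ _ _ (-_) _, AltAux.swap₂₃ _ _ (-_) _]
    simp only [AltAux.neg₃₃]
    abel

@[simp] theorem quotRep_mk (π : ThreeLie R g) (h : Submodule R g) (hh : π.IsSubalgebra h)
    (u v : h) (x : g) : (π.quotRep h hh).ρ ![u, v] (Submodule.Quotient.mk x) =
      Submodule.Quotient.mk (π.bracket ![(u : g), v, x]) := rfl

/-! ### Cohomology

The cochain spaces of the 3-Lie algebra `(g, π)` with coefficients in `V` in degrees 1, 2, 3 are
`Hom(g, V)`, `Hom(⋀³ g, V)` and `Hom(⋀² g ⊗ ⋀³ g, V)`. -/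

namespace Rep

variable {π : ThreeLie R g} (r : π.Rep V)

/-- The coboundary operator from 1-cochains to 2-cochains. -/
def d₁ : (g →ₗ[R] V) →ₗ[R] (g [⋀^Fin 3]→ₗ[R] V) where
  toFun θ := AltAux.mk₃
    (fun x₁ y₁ x₂ => - θ (π.bracket ![x₁, y₁, x₂]) + r.ρ ![x₁, y₁] (θ x₂)
      + (r.ρ ![y₁, x₂] (θ x₁) + r.ρ ![x₂, x₁] (θ y₁)))
    (fun x x' y z => by
      simp only [AltAux.add₃₁, AltAux.add₁, AltAux.add₂, map_add, LinearMap.add_apply]; abel)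
    (fun c x y z => by
      simp only [AltAux.smul₃₁, AltAux.smul₁, AltAux.smul₂, map_smul, LinearMap.smul_apply]
      module)
    (fun x y z => by
      rw [AltAux.swap₁₂ π.bracket x, AltAux.swap r.ρ x y, AltAux.swap r.ρ y z,
        AltAux.swap r.ρ z x]
      simp only [map_neg, LinearMap.neg_apply]; abel)
    (fun x y z => by
      rw [AltAux.swap₂₃ π.bracket x, AltAux.swap r.ρ x y, AltAux.swap r.ρ y z,
        AltAux.swap r.ρ z x]
      simp only [map_neg, LinearMap.neg_apply]; abel)
    (fun x z => by
      rw [AltAux.swap r.ρ z x]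
      simp)
  map_add' θ θ' := AltAux.ext₃ fun x y z => by
    simp only [AltAux.mk₃_apply, LinearMap.add_apply, map_add, AlternatingMap.add_apply]; abel
  map_smul' c θ := AltAux.ext₃ fun x y z => by
    simp only [AltAux.mk₃_apply, LinearMap.smul_apply, map_smul, AlternatingMap.smul_apply,
      RingHom.id_apply]
    module

/-- The value on `(x₁ ∧ y₁, x₂ ∧ y₂, x₃)` of the coboundary of a 2-cochain `θ`. -/
def d₂Fun (θ : g [⋀^Fin 3]→ₗ[R] V) (x₁ y₁ x₂ y₂ x₃ : g) : V :=
  - (θ ![π.bracket ![x₁, y₁, x₂], y₂, x₃] + θ ![x₂, π.bracket ![x₁, y₁, y₂], x₃])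
  + (- θ ![x₂, y₂, π.bracket ![x₁, y₁, x₃]] + θ ![x₁, y₁, π.bracket ![x₂, y₂, x₃]])
  + (r.ρ ![x₁, y₁] (θ ![x₂, y₂, x₃]) - r.ρ ![x₂, y₂] (θ ![x₁, y₁, x₃]))
  - (r.ρ ![y₂, x₃] (θ ![x₁, y₁, x₂]) + r.ρ ![x₃, x₂] (θ ![x₁, y₁, y₂]))

/-- The coboundary operator from 2-cochains to 3-cochains. -/
def d₂ : (g [⋀^Fin 3]→ₗ[R] V) →ₗ[R] (g [⋀^Fin 2]→ₗ[R] (g [⋀^Fin 3]→ₗ[R] V)) where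
  toFun θ := AltAux.mk₂
    (fun x₁ y₁ => AltAux.mk₃ (fun x₂ y₂ x₃ => r.d₂Fun θ x₁ y₁ x₂ y₂ x₃)
      (fun x x' y z => by
        simp only [d₂Fun, AltAux.add₃₁, AltAux.add₃₃, AltAux.add₁, AltAux.add₂,
          map_add, LinearMap.add_apply]; abel)
      (fun c x y z => by
        simp only [d₂Fun, AltAux.smul₃₁, AltAux.smul₃₃, AltAux.smul₁,
          AltAux.smul₂, map_smul, LinearMap.smul_apply]; module)
      (fun x y z => by
        simp only [d₂Fun]
        rw [AltAux.swap₁₂ θ (π.bracket ![x₁, y₁, x]), AltAux.swap₁₂ θ x, AltAux.swap₁₂ θ x y,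
          AltAux.swap₁₂ θ x y, AltAux.swap₁₂ π.bracket x y, AltAux.swap r.ρ x y,
          AltAux.swap r.ρ y z, AltAux.swap r.ρ z x]
        simp only [AltAux.neg₃₃, map_neg, LinearMap.neg_apply]; abel)
      (fun x y z => by
        simp only [d₂Fun]
        rw [AltAux.swap₂₃ θ (π.bracket ![x₁, y₁, x]), AltAux.swap₂₃ θ x (π.bracket _),
          AltAux.swap₂₃ θ x y (π.bracket _), AltAux.swap₂₃ θ x y z,
          AltAux.swap₂₃ π.bracket x y, AltAux.swap r.ρ x y,
          AltAux.swap r.ρ y z, AltAux.swap r.ρ z x]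
        simp only [AltAux.neg₃₃, map_neg, LinearMap.neg_apply]; abel)
      (fun x z => by
        simp only [d₂Fun]
        rw [AltAux.swap₁₂ θ x (π.bracket _), AltAux.swap r.ρ z x]
        have h0 : θ ![x₁, y₁, 0] = 0 := θ.map_coord_zero 2 rfl
        simp [h0]))
    (fun x x' y => AltAux.ext₃ fun x₂ y₂ x₃ => by
      simp only [AltAux.mk₃_apply, AlternatingMap.add_apply, d₂Fun, AltAux.add₃₁, AltAux.add₃₂,
        AltAux.add₃₃, AltAux.add₁, map_add, LinearMap.add_apply]; abel)
    (fun x y y' => AltAux.ext₃ fun x₂ y₂ x₃ => by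
      simp only [AltAux.mk₃_apply, AlternatingMap.add_apply, d₂Fun, AltAux.add₃₁, AltAux.add₃₂,
        AltAux.add₃₃, AltAux.add₂, map_add, LinearMap.add_apply]; abel)
    (fun c x y => AltAux.ext₃ fun x₂ y₂ x₃ => by
      simp only [AltAux.mk₃_apply, AlternatingMap.smul_apply, d₂Fun, AltAux.smul₃₁,
        AltAux.smul₃₂, AltAux.smul₃₃, AltAux.smul₁, map_smul,
        LinearMap.smul_apply]; module)
    (fun c x y => AltAux.ext₃ fun x₂ y₂ x₃ => by
      simp only [AltAux.mk₃_apply, AlternatingMap.smul_apply, d₂Fun, AltAux.smul₃₁,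
        AltAux.smul₃₂, AltAux.smul₃₃, AltAux.smul₂, map_smul,
        LinearMap.smul_apply]; module)
    (fun x => AltAux.ext₃ fun x₂ y₂ x₃ => by
      have h1 : ∀ b c, θ ![0, b, c] = 0 := fun b c => θ.map_coord_zero 0 rfl
      have h2 : ∀ b c, θ ![b, 0, c] = 0 := fun b c => θ.map_coord_zero 1 rfl
      have h3 : ∀ b c, θ ![b, c, 0] = 0 := fun b c => θ.map_coord_zero 2 rfl
      simp [d₂Fun, h1, h2, h3])
  map_add' θ θ' := AltAux.ext₂ fun x₁ y₁ => AltAux.ext₃ fun x y z => by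
    simp only [AltAux.mk₂_apply, AltAux.mk₃_apply, AlternatingMap.add_apply, d₂Fun, map_add]
    abel
  map_smul' c θ := AltAux.ext₂ fun x₁ y₁ => AltAux.ext₃ fun x y z => by
    simp only [AltAux.mk₂_apply, AltAux.mk₃_apply, AlternatingMap.smul_apply, d₂Fun, map_smul,
      RingHom.id_apply]
    module

theorem d₁_apply (θ : g →ₗ[R] V) (x₁ y₁ x₂ : g) :
    r.d₁ θ ![x₁, y₁, x₂] = - θ (π.bracket ![x₁, y₁, x₂]) + r.ρ ![x₁, y₁] (θ x₂)
      + (r.ρ ![y₁, x₂] (θ x₁) + r.ρ ![x₂, x₁] (θ y₁)) := rfl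

theorem d₂_apply (θ : g [⋀^Fin 3]→ₗ[R] V) (x₁ y₁ x₂ y₂ x₃ : g) :
    r.d₂ θ ![x₁, y₁] ![x₂, y₂, x₃] = r.d₂Fun θ x₁ y₁ x₂ y₂ x₃ := rfl

/-- The coboundary operators compose to zero. -/
theorem d₂_d₁ (θ : g →ₗ[R] V) : r.d₂ (r.d₁ θ) = 0 :=
  AltAux.ext₂ fun x₁ y₁ => AltAux.ext₃ fun x₂ y₂ x₃ => by
    have C : ∀ a b c d w, r.ρ ![a, b] (r.ρ ![c, d] w) =
        r.ρ ![π.bracket ![a, b, c], d] w + r.ρ ![c, π.bracket ![a, b, d]] w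
        + r.ρ ![c, d] (r.ρ ![a, b] w) := fun a b c d w => LinearMap.congr_fun (r.comm a b c d) w
    have B : ∀ a b c d w, r.ρ ![a, π.bracket ![b, c, d]] w =
        r.ρ ![c, d] (r.ρ ![a, b] w) - r.ρ ![b, d] (r.ρ ![a, c] w)
        + r.ρ ![b, c] (r.ρ ![a, d] w) := fun a b c d w =>
      LinearMap.congr_fun (r.bracket_right a b c d) w
    have S : ∀ a b w, r.ρ ![a, b] w = - r.ρ ![b, a] w := fun a b w => by
      rw [AltAux.swap]; rfl
    have F := congrArg θ (π.fundamental x₁ y₁ x₂ y₂ x₃)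
    simp only [map_add] at F
    rw [d₂_apply]
    simp only [d₂Fun, d₁_apply, map_add, map_neg, AlternatingMap.zero_apply, S x₃ x₁, S x₂ x₁,
      S y₂ x₁]
    linear_combination (norm := module) -F + C x₁ y₁ x₂ y₂ (θ x₃) + C x₁ y₁ y₂ x₃ (θ x₂)
      + C x₁ y₁ x₃ x₂ (θ y₂) + B y₁ x₂ y₂ x₃ (θ x₁) - S x₃ x₂ (r.ρ ![y₁, y₂] (θ x₁))
      - B x₁ x₂ y₂ x₃ (θ y₁) + S (π.bracket ![x₂, y₂, x₃]) x₁ (θ y₁)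
      + S x₃ x₂ (r.ρ ![x₁, y₂] (θ y₁))

/-- `d₁`, with values in the 2-cocycles. -/
def d₁Cocycle : (g →ₗ[R] V) →ₗ[R] LinearMap.ker r.d₂ :=
  r.d₁.codRestrict (LinearMap.ker r.d₂) r.d₂_d₁

/-- The second cohomology group `H²(g, V)`: 2-cocycles modulo 2-coboundaries. -/
abbrev H2 : Type _ := LinearMap.ker r.d₂ ⧸ LinearMap.range r.d₁Cocycle

end Rep

/-! ### Stability -/

section stable

variable (𝕜 E : Type*) [RCLike 𝕜] [NormedAddCommGroup E] [NormedSpace 𝕜 E]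

/-- The Grassmannian of `k`-dimensional linear subspaces of `E`. -/
def Gr (k : ℕ) : Type _ := {U : Submodule 𝕜 E // Module.finrank 𝕜 U = k}

/-- The `k`-frames of `E`: linearly independent `k`-tuples, with the subspace topology of `Eᵏ`. -/
abbrev Frame (k : ℕ) : Type _ := {v : Fin k → E // LinearIndependent 𝕜 v}

variable {𝕜 E}

/-- The subspace spanned by a frame. -/
def Frame.span {k : ℕ} (v : Frame 𝕜 E k) : Gr 𝕜 E k :=
  ⟨Submodule.span 𝕜 (Set.range v.1), by simpa using finrank_span_eq_card v.2⟩

/-- The standard topology of the Grassmannian: the quotient topology of the space of frames. -/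
instance (k : ℕ) : TopologicalSpace (Gr 𝕜 E k) :=
  TopologicalSpace.coinduced Frame.span inferInstance

/-- `π'` is `δ`-close to `π` in the `C⁰`-norm: the brackets differ by at most `δ`, uniformly
on triples of vectors of the closed unit ball. -/
def C0Close (δ : ℝ) (π π' : ThreeLie 𝕜 E) : Prop :=
  ∀ x y z : E, ‖x‖ ≤ 1 → ‖y‖ ≤ 1 → ‖z‖ ≤ 1 →
    ‖π'.bracket ![x, y, z] - π.bracket ![x, y, z]‖ ≤ δ

/-- The point `h` of the Grassmannian is stable for `π`: given any neighbourhood `W` of `h` in the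
Grassmannian, every 3-Lie structure that is sufficiently `C⁰`-close to `π` has a 3-Lie subalgebra
which lies in `W` (and so is of the same dimension as `h`). -/
def IsStable {k : ℕ} (π : ThreeLie 𝕜 E) (h : Gr 𝕜 E k) : Prop :=
  ∀ W ∈ 𝓝 h, ∃ δ > 0, ∀ π' : ThreeLie 𝕜 E, C0Close δ π π' →
    ∃ h' ∈ W, π'.IsSubalgebra h'.1

end stable

end ThreeLie

/-!
A subspace near `h` is the graph of a small linear map `η : h → V`, where `V = g ⧸ h` is embedded as
a complement of `h` in `g`. Transporting a 3-Lie bracket `A` along the shear of `g` that maps `h`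
onto the graph, one gets a 3-Lie bracket `μ = S.transport A η`, and the graph is a subalgebra for `A`
if and only if the curvature `S.curv μ`, the `V`-component of `μ` on `h`, vanishes. At `A = π` and
`η = 0` the derivative of the curvature in `η` is the coboundary operator in degree 1
(`Splitting.fderiv_graphCurv_apply`).

This derivative need not be surjective, so the implicit function theorem solves the equation
`S.curv μ = 0` only modulo a complement `K` of the coboundaries
(`exists_submodule_eventually_exists_mem`). The rest comes from the fundamental identity of `μ`: its
`V`-component on `h` is a linear equation for the curvature, with coefficients that depend
continuously on `μ` (`Splitting.bianchi_curv`). At `μ = π` the operator in this equation is the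
coboundary operator in degree 2, and the vanishing of the second cohomology says that it is injective
on the alternating maps in `K`. Injectivity on a finite-dimensional space is an open condition
(`Splitting.eventually_eq_zero_of_bianchi_eq_zero`), so it persists for `μ` near `π`, and then a
curvature that lies in `K` is zero.
-/

-- The instances on threefold iterated spaces of bounded linear maps need this depth.
set_option maxSynthPendingDepth 3

/-! ### Solving an equation modulo a complement -/

/-- Implicit function theorem without surjectivity: near a zero of `f`, the equation
`f (x, y) = 0` can be solved for `y` modulo a complement `K` of the range of the partial derivative
in `y`. -/
theorem exists_submodule_eventually_exists_mem {𝕜 X Y T : Type*} [RCLike 𝕜]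
    [NormedAddCommGroup X] [NormedSpace 𝕜 X] [FiniteDimensional 𝕜 X]
    [NormedAddCommGroup Y] [NormedSpace 𝕜 Y] [FiniteDimensional 𝕜 Y]
    [NormedAddCommGroup T] [NormedSpace 𝕜 T] [FiniteDimensional 𝕜 T]
    {f : X × Y → T} {L : X × Y →L[𝕜] T} {x₀ : X} {y₀ : Y} (hf : HasStrictFDerivAt f L (x₀, y₀))
    (h₀ : f (x₀, y₀) = 0) :
    ∃ K : Submodule 𝕜 T, (∀ y, L (0, y) ∈ K → L (0, y) = 0) ∧
      ∀ N ∈ 𝓝 (x₀, y₀), ∀ᶠ x in 𝓝 x₀, ∃ y, (x, y) ∈ N ∧ f (x, y) ∈ K := by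
  -- `P` is a projection onto the range `R` of the partial derivative, and `K` is its kernel.
  let R : Submodule 𝕜 T := (L ∘L ContinuousLinearMap.inr 𝕜 X Y).toLinearMap.range
  obtain ⟨P₀, hP₀⟩ := R.subtype.exists_leftInverse_of_injective R.ker_subtype
  let P : T →L[𝕜] R := P₀.toContinuousLinearMap
  have hP (r : R) : P r = r := LinearMap.congr_fun hP₀ r
  have : CompleteSpace R := FiniteDimensional.complete 𝕜 R
  have : CompleteSpace X := FiniteDimensional.complete 𝕜 X
  have : CompleteSpace Y := FiniteDimensional.complete 𝕜 Y
  refine ⟨P.toLinearMap.ker, fun y hy => ?_, fun N hN => ?_⟩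
  · have h1 := hP ⟨L (0, y), y, rfl⟩
    exact congrArg Subtype.val (h1.symm.trans hy)
  -- The map `(x, y) ↦ (x, P (f (x, y)))` is a submersion, so it is open at `(x₀, y₀)`.
  have hf' : HasStrictFDerivAt (fun t => (t.1, P (f t)))
      ((ContinuousLinearMap.fst 𝕜 X Y).prod (P ∘L L)) (x₀, y₀) :=
    hasStrictFDerivAt_fst.prodMk (P.hasStrictFDerivAt.comp _ hf)
  have hsurj : ((ContinuousLinearMap.fst 𝕜 X Y).prod (P ∘L L)).toLinearMap.range = ⊤ := by
    rw [LinearMap.range_eq_top]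
    rintro ⟨x, r⟩
    obtain ⟨y, hy⟩ := (r - P (L (x, 0))).2
    replace hy : L (0, y) = (r - P (L (x, 0)) : R) := hy
    refine ⟨(x, y), Prod.ext rfl ?_⟩
    have hsum : (x, y) = (x, 0) + (0, y) := by simp
    change P (L (x, y)) = r
    rw [hsum, map_add, map_add, hy, hP, add_sub_cancel]
  have hmap := hf'.map_nhds_eq_of_surj hsurj
  simp only [h₀, map_zero] at hmap
  have himage := hmap ▸ Filter.image_mem_map hN
  have hline : Filter.Tendsto (fun x => (x, (0 : R))) (𝓝 x₀) (𝓝 (x₀, 0)) :=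
    (Continuous.prodMk_left (0 : R)).tendsto x₀
  filter_upwards [hline himage] with x hx
  obtain ⟨⟨x', y⟩, hxy, heq⟩ := hx
  obtain ⟨rfl, hy⟩ := Prod.mk.inj heq
  exact ⟨y, hxy, hy⟩

/-! ### Trilinear maps between normed spaces -/

section Trilinear

variable {𝕜 D E F G : Type*} [RCLike 𝕜]
  [NormedAddCommGroup D] [NormedSpace 𝕜 D] [NormedAddCommGroup E] [NormedSpace 𝕜 E]
  [NormedAddCommGroup F] [NormedSpace 𝕜 F] [NormedAddCommGroup G] [NormedSpace 𝕜 G]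

/-- Bounded trilinear maps, in curried form. -/
abbrev Tri (𝕜 E F : Type*) [RCLike 𝕜] [NormedAddCommGroup E] [NormedSpace 𝕜 E]
    [NormedAddCommGroup F] [NormedSpace 𝕜 F] : Type _ :=
  E →L[𝕜] E →L[𝕜] E →L[𝕜] F

/-- The operator `B ↦ S ∘ B ∘ N` on bounded linear maps. -/
noncomputable def conjCLM (S : F →L[𝕜] G) (N : D →L[𝕜] E) : (E →L[𝕜] F) →L[𝕜] (D →L[𝕜] G) :=
  (ContinuousLinearMap.compL 𝕜 D F G S) ∘L ((ContinuousLinearMap.compL 𝕜 D E F).flip N)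

namespace Tri

/-- The operator on trilinear maps that sends `A` to `(x, y, z) ↦ Q (A (N x) (N y) (N z))`. -/
noncomputable def conj (Q : F →L[𝕜] G) (N : D →L[𝕜] E) : Tri 𝕜 E F →L[𝕜] Tri 𝕜 D G :=
  conjCLM (conjCLM (conjCLM Q N) N) N

@[simp] theorem conj_apply (Q : F →L[𝕜] G) (N : D →L[𝕜] E) (A : Tri 𝕜 E F) (x y z : D) :
    conj Q N A x y z = Q (A (N x) (N y) (N z)) := rfl

theorem contDiff_conj {X : Type*} [NormedAddCommGroup X] [NormedSpace 𝕜 X]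
    {Q : X → F →L[𝕜] G} {N : X → D →L[𝕜] E} {A : X → Tri 𝕜 E F} (hQ : ContDiff 𝕜 1 Q)
    (hN : ContDiff 𝕜 1 N) (hA : ContDiff 𝕜 1 A) :
    ContDiff 𝕜 1 fun t => conj (Q t) (N t) (A t) := by
  unfold conj conjCLM
  fun_prop

/-- The bounded trilinear map `A` is alternating. -/
def IsAlt (A : Tri 𝕜 E F) : Prop :=
  (∀ x z, A x x z = 0) ∧ ∀ x y, A x y y = 0

theorem IsAlt.swap₁₂ {A : Tri 𝕜 E F} (hA : A.IsAlt) (x y z : E) : A x y z = - A y x z := by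
  have h := hA.1 (x + y) z
  simp only [map_add, add_apply, hA.1, zero_add, add_zero] at h
  exact eq_neg_of_add_eq_zero_right h

theorem IsAlt.swap₂₃ {A : Tri 𝕜 E F} (hA : A.IsAlt) (x y z : E) : A x y z = - A x z y := by
  have h := hA.2 x (y + z)
  simp only [map_add, add_apply, hA.2, zero_add, add_zero] at h
  exact eq_neg_of_add_eq_zero_right h

theorem IsAlt.conj {A : Tri 𝕜 E F} (hA : A.IsAlt) (Q : F →L[𝕜] G) (N : D →L[𝕜] E) :
    (conj Q N A).IsAlt :=
  ⟨fun x z => by simp [hA.1], fun x y => by simp [hA.2]⟩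

theorem isClosed_setOf_isAlt : IsClosed {A : Tri 𝕜 E F | A.IsAlt} := by
  simp only [IsAlt, Set.ofPred_and, Set.ofPred_forall]
  refine .inter (isClosed_iInter fun x => isClosed_iInter fun z => ?_)
    (isClosed_iInter fun x => isClosed_iInter fun z => ?_)
  all_goals exact isClosed_eq (by fun_prop) continuous_const

theorem IsAlt.smul {A : Tri 𝕜 E F} (hA : A.IsAlt) (c : 𝕜) : (c • A).IsAlt :=
  ⟨fun x z => by simp [hA.1], fun x y => by simp [hA.2]⟩

theorem norm_le_of_unit_ball {A : Tri 𝕜 E F} {δ : ℝ} (hδ : 0 ≤ δ)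
    (hA : ∀ x y z, ‖x‖ ≤ 1 → ‖y‖ ≤ 1 → ‖z‖ ≤ 1 → ‖A x y z‖ ≤ δ) : ‖A‖ ≤ δ :=
  ContinuousLinearMap.opNorm_le_of_unit_norm hδ fun x hx =>
    ContinuousLinearMap.opNorm_le_of_unit_norm hδ fun y hy =>
      ContinuousLinearMap.opNorm_le_of_unit_norm hδ fun z hz => hA x y z hx.le hy.le hz.le

/-- `A` is a 3-Lie bracket: it is alternating and satisfies the fundamental identity. -/
structure IsThreeLie (A : Tri 𝕜 E E) : Prop where
  isAlt : A.IsAlt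
  fundamental : ∀ x₁ x₂ x₃ x₄ x₅ : E,
    A x₁ x₂ (A x₃ x₄ x₅) =
      A (A x₁ x₂ x₃) x₄ x₅ + A x₃ (A x₁ x₂ x₄) x₅ + A x₃ x₄ (A x₁ x₂ x₅)

/-- Transport of structure along an automorphism `Φ` with inverse `Ψ`. -/
theorem IsThreeLie.conj {A : Tri 𝕜 E E} (hA : A.IsThreeLie) {Φ Ψ : E →L[𝕜] E}
    (hΦΨ : ∀ x, Φ (Ψ x) = x) : (conj Ψ Φ A).IsThreeLie where
  isAlt := hA.isAlt.conj Ψ Φ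
  fundamental x₁ x₂ x₃ x₄ x₅ := by
    simp only [conj_apply, hΦΨ, ← map_add, ← hA.fundamental]

end Tri

end Trilinear

/-! ### Graphs over a split subspace -/

/-- A topological splitting of the short exact sequence `0 → H → E → V → 0`. -/
structure Splitting (𝕜 H E V : Type*) [RCLike 𝕜] [NormedAddCommGroup H] [NormedSpace 𝕜 H]
    [NormedAddCommGroup E] [NormedSpace 𝕜 E] [NormedAddCommGroup V] [NormedSpace 𝕜 V] where
  incl : H →L[𝕜] E
  proj : E →L[𝕜] H
  quot : E →L[𝕜] V
  sec : V →L[𝕜] E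
  proj_incl : ∀ x, proj (incl x) = x
  quot_sec : ∀ v, quot (sec v) = v
  quot_incl : ∀ x, quot (incl x) = 0
  proj_sec : ∀ v, proj (sec v) = 0
  incl_add_sec : ∀ w, incl (proj w) + sec (quot w) = w

namespace Splitting

variable {𝕜 H E V : Type*} [RCLike 𝕜] [NormedAddCommGroup H] [NormedSpace 𝕜 H]
    [NormedAddCommGroup E] [NormedSpace 𝕜 E] [NormedAddCommGroup V] [NormedSpace 𝕜 V]
    (S : Splitting 𝕜 H E V)

/-- The shear of `E` that maps `H` onto the graph of `η : H → V`. -/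
noncomputable def shear (η : H →L[𝕜] V) : E →L[𝕜] E :=
  ContinuousLinearMap.id 𝕜 E + S.sec ∘L η ∘L S.proj

@[simp] theorem shear_apply (η : H →L[𝕜] V) (w : E) :
    S.shear η w = w + S.sec (η (S.proj w)) := rfl

theorem shear_shear_neg (η : H →L[𝕜] V) (w : E) : S.shear η (S.shear (-η) w) = w := by
  simp [S.proj_sec]

theorem contDiff_shear : ContDiff 𝕜 1 S.shear := by
  unfold shear; fun_prop

/-- The bracket `A`, transported along the shear by `η`. -/
noncomputable def transport (A : Tri 𝕜 E E) (η : H →L[𝕜] V) : Tri 𝕜 E E :=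
  Tri.conj (S.shear (-η)) (S.shear η) A

theorem contDiff_transport :
    ContDiff 𝕜 1 fun t : Tri 𝕜 E E × (H →L[𝕜] V) => S.transport t.1 t.2 :=
  Tri.contDiff_conj (S.contDiff_shear.comp contDiff_snd.neg) (S.contDiff_shear.comp contDiff_snd)
    contDiff_fst

theorem isThreeLie_transport {A : Tri 𝕜 E E} (hA : A.IsThreeLie) (η : H →L[𝕜] V) :
    (S.transport A η).IsThreeLie :=
  hA.conj (S.shear_shear_neg η)

theorem transport_zero (A : Tri 𝕜 E E) : S.transport A 0 = A := by
  ext x y z; simp [transport]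

/-- The component in `V` of the restriction of a bracket to `H`: the obstruction to `H` being a
subalgebra. -/
noncomputable def curv : Tri 𝕜 E E →L[𝕜] Tri 𝕜 H V :=
  Tri.conj S.quot S.incl

theorem curv_apply (A : Tri 𝕜 E E) (x y z : H) :
    S.curv A x y z = S.quot (A (S.incl x) (S.incl y) (S.incl z)) := rfl

/-- The degree 1 coboundary of `η`, written with the splitting; this makes sense even if `H` is not
a subalgebra. -/
noncomputable def cobdry (A : Tri 𝕜 E E) (η : H →L[𝕜] V) (x y z : H) : V :=
  - η (S.proj (A (S.incl x) (S.incl y) (S.incl z)))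
    + (S.quot (A (S.sec (η x)) (S.incl y) (S.incl z))
      + S.quot (A (S.incl x) (S.sec (η y)) (S.incl z))
      + S.quot (A (S.incl x) (S.incl y) (S.sec (η z))))

/-- The operator on 2-cochains which expresses that part of the fundamental identity of `A` on `H`
that is linear in the curvature. For a bracket for which `H` is a subalgebra, it is the degree 2
coboundary. -/
noncomputable def bianchi (A : Tri 𝕜 E E) (θ : Tri 𝕜 H V) (x₁ y₁ x₂ y₂ x₃ : H) : V :=
  (θ x₁ y₁ (S.proj (A (S.incl x₂) (S.incl y₂) (S.incl x₃)))
    + S.quot (A (S.incl x₁) (S.incl y₁) (S.sec (θ x₂ y₂ x₃))))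
  - (θ (S.proj (A (S.incl x₁) (S.incl y₁) (S.incl x₂))) y₂ x₃
    + S.quot (A (S.sec (θ x₁ y₁ x₂)) (S.incl y₂) (S.incl x₃)))
  - (θ x₂ (S.proj (A (S.incl x₁) (S.incl y₁) (S.incl y₂))) x₃
    + S.quot (A (S.incl x₂) (S.sec (θ x₁ y₁ y₂)) (S.incl x₃)))
  - (θ x₂ y₂ (S.proj (A (S.incl x₁) (S.incl y₁) (S.incl x₃)))
    + S.quot (A (S.incl x₂) (S.incl y₂) (S.sec (θ x₁ y₁ x₃))))

/-- The Bianchi identity: the curvature of a 3-Lie bracket is killed by the linear operator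
`S.bianchi A`. -/
theorem bianchi_curv {A : Tri 𝕜 E E} (hA : A.IsThreeLie) (x₁ y₁ x₂ y₂ x₃ : H) :
    S.bianchi A (S.curv A) x₁ y₁ x₂ y₂ x₃ = 0 := by
  have h := congrArg S.quot (hA.fundamental (S.incl x₁) (S.incl y₁) (S.incl x₂) (S.incl y₂)
    (S.incl x₃))
  rw [← sub_eq_zero] at h
  -- Every inner bracket splits into its components in `H` and in `V`.
  rw [← S.incl_add_sec (A (S.incl x₂) (S.incl y₂) (S.incl x₃)),
    ← S.incl_add_sec (A (S.incl x₁) (S.incl y₁) (S.incl x₂)),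
    ← S.incl_add_sec (A (S.incl x₁) (S.incl y₁) (S.incl y₂)),
    ← S.incl_add_sec (A (S.incl x₁) (S.incl y₁) (S.incl x₃))] at h
  simp only [map_add, add_apply] at h
  rw [← h]
  simp only [bianchi, curv_apply]
  abel

theorem bianchi_smul (A : Tri 𝕜 E E) (c : 𝕜) (θ : Tri 𝕜 H V) (x₁ y₁ x₂ y₂ x₃ : H) :
    S.bianchi A (c • θ) x₁ y₁ x₂ y₂ x₃ = c • S.bianchi A θ x₁ y₁ x₂ y₂ x₃ := by
  simp only [bianchi, smul_apply, map_smul, smul_add, smul_sub]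

theorem continuous_bianchi (x₁ y₁ x₂ y₂ x₃ : H) :
    Continuous fun t : Tri 𝕜 E E × Tri 𝕜 H V => S.bianchi t.1 t.2 x₁ y₁ x₂ y₂ x₃ := by
  unfold bianchi
  fun_prop

/-- If `S.bianchi A₀` is injective on the alternating elements of a subspace `K`, then so is
`S.bianchi A` for all `A` near `A₀`, by compactness of the unit sphere. -/
theorem eventually_eq_zero_of_bianchi_eq_zero [FiniteDimensional 𝕜 H] [FiniteDimensional 𝕜 V]
    (K : Submodule 𝕜 (Tri 𝕜 H V)) (A₀ : Tri 𝕜 E E)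
    (hK : ∀ θ ∈ K, θ.IsAlt → (∀ x₁ y₁ x₂ y₂ x₃, S.bianchi A₀ θ x₁ y₁ x₂ y₂ x₃ = 0) → θ = 0) :
    ∀ᶠ A in 𝓝 A₀, ∀ θ ∈ K, θ.IsAlt →
      (∀ x₁ y₁ x₂ y₂ x₃, S.bianchi A θ x₁ y₁ x₂ y₂ x₃ = 0) → θ = 0 := by
  have : ProperSpace (Tri 𝕜 H V) := FiniteDimensional.proper_rclike 𝕜 _
  have hc : IsCompact (Metric.sphere (0 : Tri 𝕜 H V) 1 ∩ (K ∩ {θ | θ.IsAlt})) :=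
    (isCompact_sphere _ _).inter_right
      (K.closed_of_finiteDimensional.inter Tri.isClosed_setOf_isAlt)
  have key := hc.eventually_forall_of_forall_eventually (x₀ := A₀)
    (P := fun A θ => ∃ x₁ y₁ x₂ y₂ x₃, S.bianchi A θ x₁ y₁ x₂ y₂ x₃ ≠ 0) (by
      rintro θ ⟨hθ, hθK, hθa⟩
      have hne : θ ≠ 0 := by
        rintro rfl; simp at hθ
      have hex : ∃ x₁ y₁ x₂ y₂ x₃, S.bianchi A₀ θ x₁ y₁ x₂ y₂ x₃ ≠ 0 := by
        by_contra! hcon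
        exact hne (hK θ hθK hθa hcon)
      obtain ⟨x₁, y₁, x₂, y₂, x₃, hx⟩ := hex
      filter_upwards [(S.continuous_bianchi x₁ y₁ x₂ y₂ x₃).continuousAt.eventually_ne hx]
        with t ht
      exact ⟨x₁, y₁, x₂, y₂, x₃, ht⟩)
  filter_upwards [key] with A hA θ hθK hθa hθ
  by_contra hne
  obtain ⟨x₁, y₁, x₂, y₂, x₃, hx⟩ := hA (((‖θ‖ : 𝕜)⁻¹) • θ)
    ⟨by simp [norm_smul, norm_ne_zero_iff.2 hne], K.smul_mem _ hθK, hθa.smul _⟩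
  exact hx (by rw [bianchi_smul, hθ, smul_zero])

end Splitting

/-! ### The equation for the slope of a subalgebra -/

namespace Splitting

variable {𝕜 H E V : Type*} [RCLike 𝕜] [NormedAddCommGroup H] [NormedSpace 𝕜 H]
    [NormedAddCommGroup E] [NormedSpace 𝕜 E] [NormedAddCommGroup V] [NormedSpace 𝕜 V]
    (S : Splitting 𝕜 H E V)

/-- The curvature of the graph of `η`, as a map of the bracket and `η`. -/
noncomputable def graphCurv (t : Tri 𝕜 E E × (H →L[𝕜] V)) : Tri 𝕜 H V :=
  S.curv (S.transport t.1 t.2)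

theorem contDiff_graphCurv : ContDiff 𝕜 1 S.graphCurv :=
  S.curv.contDiff.comp S.contDiff_transport

theorem graphCurv_apply (A : Tri 𝕜 E E) (η : H →L[𝕜] V) (x y z : H) :
    S.graphCurv (A, η) x y z =
      S.quot (A (S.incl x + S.sec (η x)) (S.incl y + S.sec (η y)) (S.incl z + S.sec (η z)))
        - η (S.proj (A (S.incl x + S.sec (η x)) (S.incl y + S.sec (η y))
          (S.incl z + S.sec (η z)))) := by
  simp [graphCurv, curv_apply, transport, S.proj_incl, S.quot_sec, sub_eq_add_neg]

/-- The linearisation in `η` of the curvature of the graph is the degree 1 coboundary. -/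
theorem fderiv_graphCurv_apply (A : Tri 𝕜 E E) (η : H →L[𝕜] V) (x y z : H) :
    fderiv 𝕜 S.graphCurv (A, 0) (0, η) x y z = S.cobdry A η x y z := by
  have hd : HasFDerivAt S.graphCurv (fderiv 𝕜 S.graphCurv (A, 0)) (A, 0) :=
    (S.contDiff_graphCurv.differentiable one_ne_zero _).hasFDerivAt
  have hs : HasDerivAt (fun t : 𝕜 => t • η) η 0 := by
    simpa using (hasDerivAt_id (0 : 𝕜)).smul_const η
  have hl : HasDerivAt (fun t : 𝕜 => (A, t • η)) ((0 : Tri 𝕜 E E), η) 0 :=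
    (hasDerivAt_const (0 : 𝕜) A).prodMk hs
  have h1 : HasDerivAt (fun t : 𝕜 => S.graphCurv (A, t • η))
      (fderiv 𝕜 S.graphCurv (A, 0) (0, η)) 0 := by
    have hd' : HasFDerivAt S.graphCurv (fderiv 𝕜 S.graphCurv (A, 0)) (A, (0 : 𝕜) • η) := by
      rwa [zero_smul]
    exact hd'.comp_hasDerivAt (0 : 𝕜) hl
  have h2 : HasDerivAt (fun t : 𝕜 => S.graphCurv (A, t • η) x y z)
      (fderiv 𝕜 S.graphCurv (A, 0) (0, η) x y z) 0 := by
    have ev (w : H) : HasDerivAt (fun _ : 𝕜 => w) 0 (0 : 𝕜) := hasDerivAt_const (0 : 𝕜) w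
    have hx := h1.clm_apply (ev x)
    have hy := hx.clm_apply (ev y)
    have hz := hy.clm_apply (ev z)
    simpa using hz
  have arg (w : H) : HasDerivAt (fun t : 𝕜 => S.incl w + t • S.sec (η w)) (S.sec (η w)) 0 := by
    simpa using ((hasDerivAt_id (0 : 𝕜)).smul_const (S.sec (η w))).const_add (S.incl w)
  -- The explicit formula for the curvature is differentiated along the line `t ↦ t • η`.
  have hA := (((A.hasFDerivAt.comp_hasDerivAt (0 : 𝕜) (arg x)).clm_apply (arg y)).clm_apply
    (arg z))
  have h3 := (S.quot.hasFDerivAt.comp_hasDerivAt (0 : 𝕜) hA).sub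
    ((hasDerivAt_id (0 : 𝕜)).smul ((η ∘L S.proj).hasFDerivAt.comp_hasDerivAt (0 : 𝕜) hA))
  have h4 : HasDerivAt (fun t : 𝕜 => S.graphCurv (A, t • η) x y z) (S.cobdry A η x y z) 0 := by
    refine (h3.congr_deriv ?_).congr_of_eventuallyEq (.of_forall fun t => ?_)
    · simp [cobdry]
      abel
    · simp [graphCurv_apply]
  exact h2.unique h4

/-- If every alternating 2-cocycle is a coboundary, then for every 3-Lie bracket `A` near `A₀` some
graph over `H` with small slope has zero curvature. -/
theorem eventually_exists_graphCurv_eq_zero [FiniteDimensional 𝕜 H] [FiniteDimensional 𝕜 E]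
    [FiniteDimensional 𝕜 V] (A₀ : Tri 𝕜 E E) (h₀ : S.curv A₀ = 0)
    (hexact : ∀ θ : Tri 𝕜 H V, θ.IsAlt →
      (∀ x₁ y₁ x₂ y₂ x₃, S.bianchi A₀ θ x₁ y₁ x₂ y₂ x₃ = 0) →
      ∃ η : H →L[𝕜] V, ∀ x y z, θ x y z = S.cobdry A₀ η x y z)
    {N : Set (H →L[𝕜] V)} (hN : N ∈ 𝓝 0) :
    ∀ᶠ A in 𝓝 A₀, A.IsThreeLie → ∃ η ∈ N, S.graphCurv (A, η) = 0 := by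
  have hzero : S.graphCurv (A₀, 0) = 0 := by
    rw [graphCurv, transport_zero, h₀]
  obtain ⟨K, hK, hsol⟩ := exists_submodule_eventually_exists_mem
    (S.contDiff_graphCurv.contDiffAt.hasStrictFDerivAt one_ne_zero) hzero
  -- The only cocycle in `K` is zero; this persists for brackets near `A₀`.
  have hinj := S.eventually_eq_zero_of_bianchi_eq_zero K A₀ fun θ hθ hθa hθ0 => by
    obtain ⟨η, hη⟩ := hexact θ hθa hθ0
    have heq : fderiv 𝕜 S.graphCurv (A₀, 0) (0, η) = θ := by
      ext x y z
      rw [hη, fderiv_graphCurv_apply]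
    rw [← heq] at hθ ⊢
    exact hK η hθ
  rw [← S.transport_zero A₀] at hinj
  have hinj' := S.contDiff_transport.continuous.continuousAt (x := (A₀, 0)) |>.eventually hinj
  have hN' : ∀ᶠ t : Tri 𝕜 E E × (H →L[𝕜] V) in 𝓝 (A₀, 0), t.2 ∈ N :=
    continuous_snd.continuousAt.eventually hN
  filter_upwards [hsol _ (hinj'.and hN')] with A ⟨η, ⟨hker, hηN⟩, hη⟩ hLie
  have hLie' := S.isThreeLie_transport hLie η
  exact ⟨η, hηN, hker _ hη (hLie'.isAlt.conj _ _) (S.bianchi_curv hLie')⟩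

/-- A graph without curvature is closed under the bracket. -/
theorem exists_eq_of_graphCurv_eq_zero {A : Tri 𝕜 E E} {η : H →L[𝕜] V}
    (h : S.graphCurv (A, η) = 0) (x y z : H) :
    ∃ w, A (S.incl x + S.sec (η x)) (S.incl y + S.sec (η y)) (S.incl z + S.sec (η z))
      = S.incl w + S.sec (η w) := by
  have h1 : S.graphCurv (A, η) x y z = 0 := by rw [h]; rfl
  rw [graphCurv_apply, sub_eq_zero] at h1
  exact ⟨_, by rw [← h1, S.incl_add_sec]⟩

end Splitting

/-! ### Splittings from subspaces, and the Grassmannian -/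

section Subspace

variable {𝕜 g : Type*} [RCLike 𝕜] [NormedAddCommGroup g] [NormedSpace 𝕜 g]
  [FiniteDimensional 𝕜 g]

theorem Splitting.exists_of_submodule (h : Submodule 𝕜 g) [IsClosed (h : Set g)] :
    ∃ S : Splitting 𝕜 h g (g ⧸ h), (∀ x : h, S.incl x = x) ∧ ∀ w, S.quot w = h.mkQ w := by
  obtain ⟨p, hp⟩ := h.subtype.exists_leftInverse_of_injective h.ker_subtype
  have hp' (x : h) : p x = x := LinearMap.congr_fun hp x
  -- The section of the quotient map whose range is the kernel of the projection `p` onto `h`.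
  let s : (g ⧸ h) →ₗ[𝕜] g := h.liftQ (LinearMap.id - h.subtype ∘ₗ p) fun x hx => by
    simp [hp' ⟨x, hx⟩]
  have hs (w : g) : s (h.mkQ w) = w - p w := rfl
  refine ⟨{
    incl := h.subtype.toContinuousLinearMap
    proj := p.toContinuousLinearMap
    quot := h.mkQ.toContinuousLinearMap
    sec := s.toContinuousLinearMap
    proj_incl := hp'
    quot_sec := fun v => ?_
    quot_incl := fun x => (Submodule.Quotient.mk_eq_zero h).2 x.2
    proj_sec := fun v => ?_
    incl_add_sec := fun w => ?_ }, fun _ => rfl, fun _ => rfl⟩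
  · obtain ⟨w, rfl⟩ := h.mkQ_surjective v
    change h.mkQ (s (h.mkQ w)) = h.mkQ w
    rw [hs, map_sub, sub_eq_self]
    exact (Submodule.Quotient.mk_eq_zero h).2 (p w).2
  · obtain ⟨w, rfl⟩ := h.mkQ_surjective v
    change p (s (h.mkQ w)) = 0
    rw [hs, map_sub, hp', sub_self]
  · change (p w : g) + s (h.mkQ w) = w
    rw [hs, add_sub_cancel]

/-- If a family of injective linear maps `f t : h → g` depends continuously on `t` and is the
inclusion at `t₀`, then the image of `f t` is near `h` in the Grassmannian for `t` near `t₀`: the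
image of a basis of `h` is a frame that varies continuously. -/
theorem ThreeLie.Gr.eventually_exists_eq_range {k : ℕ} (h : ThreeLie.Gr 𝕜 g k)
    {T : Type*} [TopologicalSpace T] (f : T → (h.1 →ₗ[𝕜] g)) (t₀ : T)
    (hf : ∀ x, Continuous fun t => f t x) (hf₀ : ∀ x : h.1, f t₀ x = x)
    (hinj : ∀ t, Function.Injective (f t)) {W : Set (ThreeLie.Gr 𝕜 g k)} (hW : W ∈ 𝓝 h) :
    ∀ᶠ t in 𝓝 t₀, ∃ h' ∈ W, h'.1 = LinearMap.range (f t) := by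
  let b := Module.finBasisOfFinrankEq 𝕜 h.1 h.2
  let F : T → ThreeLie.Frame 𝕜 g k := fun t =>
    ⟨fun i => f t (b i), b.linearIndependent.map' (f t) (LinearMap.ker_eq_bot.2 (hinj t))⟩
  have hF : Continuous F :=
    Continuous.subtype_mk (continuous_pi fun i => hf (b i)) _
  have hspan : Continuous (ThreeLie.Frame.span : ThreeLie.Frame 𝕜 g k → ThreeLie.Gr 𝕜 g k) :=
    continuous_coinduced_rng
  have hval (t : T) : ((F t).span).1 = LinearMap.range (f t) := by
    change Submodule.span 𝕜 (Set.range (f t ∘ b)) = _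
    rw [Set.range_comp, Submodule.span_image, b.span_eq, Submodule.map_top]
  have h₀ : (F t₀).span = h := by
    refine Subtype.ext ((hval t₀).trans ?_)
    rw [show f t₀ = h.1.subtype from LinearMap.ext hf₀, Submodule.range_subtype]
  have hev := (hspan.comp hF).continuousAt (x := t₀) (show W ∈ 𝓝 ((F t₀).span) by rwa [h₀])
  filter_upwards [hev] with t ht
  exact ⟨_, ht, hval t⟩

end Subspace

/-! ### From 3-Lie structures to bounded trilinear maps -/

namespace ThreeLie

section toTri

variable {𝕜 g : Type*} [RCLike 𝕜] [NormedAddCommGroup g] [NormedSpace 𝕜 g]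
  [FiniteDimensional 𝕜 g]

/-- The bracket of a 3-Lie structure as a bounded trilinear map. -/
noncomputable def toTri (π : ThreeLie 𝕜 g) : Tri 𝕜 g g :=
  LinearMap.toContinuousLinearMap
    { toFun x := LinearMap.toContinuousLinearMap
        { toFun y := LinearMap.toContinuousLinearMap (π.ad x y)
          map_add' y y' := by ext z; exact AltAux.add₃₂ π.bracket x y y' z
          map_smul' c y := by ext z; exact AltAux.smul₃₂ π.bracket c x y z }
      map_add' x x' := by ext y z; exact AltAux.add₃₁ π.bracket x x' y z
      map_smul' c x := by ext y z; exact AltAux.smul₃₁ π.bracket c x y z }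

@[simp] theorem toTri_apply (π : ThreeLie 𝕜 g) (x y z : g) :
    π.toTri x y z = π.bracket ![x, y, z] := rfl

theorem isThreeLie_toTri (π : ThreeLie 𝕜 g) : π.toTri.IsThreeLie where
  isAlt := ⟨fun x z => by simp, fun x y => by
    rw [toTri_apply, AltAux.swap₁₂, AltAux.swap₂₃, AltAux.alt₁₂, neg_zero, neg_zero]⟩
  fundamental := π.fundamental

theorem C0Close.norm_toTri_sub_le {π π' : ThreeLie 𝕜 g} {δ : ℝ} (hδ : 0 ≤ δ)
    (h : C0Close δ π π') : ‖π'.toTri - π.toTri‖ ≤ δ :=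
  Tri.norm_le_of_unit_ball hδ h

/-- If the second cohomology vanishes, then every alternating solution of the linearised Bianchi
identity is a coboundary. -/
theorem exists_eq_cobdry_of_bianchi_eq_zero (π : ThreeLie 𝕜 g) (h : Submodule 𝕜 g)
    [IsClosed (h : Set g)] (hh : π.IsSubalgebra h) (hH2 : Subsingleton (π.quotRep h hh).H2)
    (S : Splitting 𝕜 h g (g ⧸ h)) (hSi : ∀ x : h, S.incl x = x)
    (hSq : ∀ w, S.quot w = h.mkQ w) (θ : Tri 𝕜 h (g ⧸ h)) (hθ : θ.IsAlt)
    (hθ0 : ∀ x₁ y₁ x₂ y₂ x₃, S.bianchi π.toTri θ x₁ y₁ x₂ y₂ x₃ = 0) :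
    ∃ η : h →L[𝕜] g ⧸ h, ∀ x y z, θ x y z = S.cobdry π.toTri η x y z := by
  let r := π.quotRep h hh
  have hproj (x y z : h) : S.proj (π.bracket ![(x : g), y, z]) =
      (π.restrict h hh).bracket ![x, y, z] := by
    rw [← restrict_bracket π h hh, ← hSi, S.proj_incl]
  -- The representation is computed on the representative `S.sec w` of `w`.
  have hρ (u v : h) (w : g ⧸ h) : r.ρ ![u, v] w = h.mkQ (π.bracket ![(u : g), v, S.sec w]) := by
    conv_lhs => rw [← S.quot_sec w, hSq]
    rfl
  let θ' : h [⋀^Fin 3]→ₗ[𝕜] (g ⧸ h) := AltAux.mk₃ (fun x y z => θ x y z)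
    (fun _ _ _ _ => by simp) (fun _ _ _ _ => by simp) hθ.swap₁₂ hθ.swap₂₃ hθ.1
  have hθ' (x y z : h) : θ' ![x, y, z] = θ x y z := rfl
  have hker : r.d₂ θ' = 0 := AltAux.ext₂ fun x₁ y₁ => AltAux.ext₃ fun x₂ y₂ x₃ => by
    rw [Rep.d₂_apply]
    refine Eq.trans ?_ (hθ0 x₁ y₁ x₂ y₂ x₃)
    simp only [Rep.d₂Fun, Splitting.bianchi, hθ', hSi, toTri_apply, hproj, hρ, hSq]
    rw [AltAux.swap₁₂ π.bracket (S.sec _), AltAux.swap₂₃ π.bracket (y₂ : g) (S.sec _),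
      AltAux.swap₁₂ π.bracket (x₃ : g), AltAux.swap₂₃ π.bracket (x₂ : g) (S.sec _)]
    simp only [map_neg]
    abel
  obtain ⟨η, hη⟩ : (⟨θ', hker⟩ : LinearMap.ker r.d₂) ∈ LinearMap.range r.d₁Cocycle := by
    rw [← Submodule.Quotient.mk_eq_zero]
    exact Subsingleton.elim (α := r.H2) _ _
  refine ⟨LinearMap.toContinuousLinearMap η, fun x y z => ?_⟩
  have h1 : r.d₁ η = θ' := congrArg Subtype.val hη
  rw [← hθ', ← h1, Rep.d₁_apply]
  simp only [Splitting.cobdry, hSi, toTri_apply, hproj, hρ, hSq,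
    LinearMap.coe_toContinuousLinearMap']
  rw [AltAux.swap₁₂ π.bracket (S.sec _), AltAux.swap₂₃ π.bracket (y : g) (S.sec _),
    AltAux.swap₁₂ π.bracket (z : g), AltAux.swap₂₃ π.bracket (x : g) (S.sec _)]
  simp only [map_neg]
  abel

end toTri

end ThreeLie

/-! ### Stability -/

theorem mainTheorem5 {𝕜 g : Type*} [RCLike 𝕜] [NormedAddCommGroup g] [NormedSpace 𝕜 g]
    [FiniteDimensional 𝕜 g] (π : ThreeLie 𝕜 g) (k : ℕ) (h : ThreeLie.Gr 𝕜 g k)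
    (hh : π.IsSubalgebra h.1) (hH2 : Subsingleton (π.quotRep h.1 hh).H2) :
    π.IsStable h := by
  intro W hW
  have : IsClosed (h.1 : Set g) := h.1.closed_of_finiteDimensional
  obtain ⟨S, hSi, hSq⟩ := Splitting.exists_of_submodule h.1
  let f : (h.1 →L[𝕜] g ⧸ h.1) → (h.1 →ₗ[𝕜] g) := fun η =>
    (S.incl + S.sec ∘L η : h.1 →L[𝕜] g)
  have hf (η : h.1 →L[𝕜] g ⧸ h.1) (x : h.1) : f η x = S.incl x + S.sec (η x) := rfl
  have hgr := h.eventually_exists_eq_range f 0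
    (fun x => by simp only [hf]; fun_prop) (fun x => by simp [hf, hSi])
    (fun η => Function.LeftInverse.injective (g := S.proj) fun x => by
      simp [hf, S.proj_incl, S.proj_sec]) hW
  have hcurv : S.curv π.toTri = 0 := by
    ext x y z
    rw [S.curv_apply, hSq, hSi, hSi, hSi]
    exact (Submodule.Quotient.mk_eq_zero _).2 (hh x x.2 y y.2 z z.2)
  have hev := S.eventually_exists_graphCurv_eq_zero π.toTri hcurv
    (π.exists_eq_cobdry_of_bianchi_eq_zero h.1 hh hH2 S hSi hSq) hgr
  obtain ⟨δ, hδ, hball⟩ := Metric.nhds_basis_closedBall.eventually_iff.1 hev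
  refine ⟨δ, hδ, fun π' hπ' => ?_⟩
  obtain ⟨η, ⟨h', hW', hh'⟩, hη⟩ := hball
    (mem_closedBall_iff_norm.2 (hπ'.norm_toTri_sub_le hδ.le)) π'.isThreeLie_toTri
  refine ⟨h', hW', ?_⟩
  unfold ThreeLie.IsSubalgebra
  rw [hh']
  rintro _ ⟨x, rfl⟩ _ ⟨y, rfl⟩ _ ⟨z, rfl⟩
  obtain ⟨w, hw⟩ := S.exists_eq_of_graphCurv_eq_zero hη x y z
  exact ⟨w, hw.symm⟩
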